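/- **Proposition 7.8 (Sweedler coring).** All rings are associative and unital, not necessarily commutative. Two objects $X,Y$ of a category with finite coproducts are called *similar* if there are positive integers $n,m$ such that $X$ is a retract of the coproduct $Y^n$ of $n$ copies of $Y$ and $Y$ is a retract of the coproduct $X^m$ of $m$ copies of $X$. For functors $\mathcal B\to\mathcal A$, where $\mathcal A$ has finite coproducts, similarity is understood in the functor category, i.e. with pointwise coproducts and natural transformations. A functor $F:\mathcal A\to\mathcal B$ is *quasi-Frobenius* if it has a left adjoint $L$ and a right adjoint $R$ that are similar as functors. A ring homomorphism $\rho:R\to S$ is a *quasi-Frobenius extension* if $S$ is finitely generated and projective as a left $R$-module and the $(S,R)$-bimodules $S$ and $\mathrm{Hom}_R({}_RS,{}_RR)$ are similar, where $(sf)(x)=f(xs)$ and $(fr)(x)=f(x)r$. An $A$-coring $\mathfrak C$ is *quasi-Frobenius* if the induction functor $-\otimes_A\mathfrak C:\mathcal M_A\to\mathcal M^{\mathfrak C}$ from right $A$-modules to right $\mathfrak C$-comodules (with coaction $M\otimes_A\Delta$ on $M\otimes_A\mathfrak C$) is a quasi-Frobenius functor. Let $\rho:R\to S$ be a ring homomorphism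 and let $\mathfrak C=S\otimes_RS$ be its Sweedler coring, i.e. the $S$-bimodule $S\otimes_RS$ with comultiplication $\Delta(s\otimes t)=(s\otimes 1)\otimes_S(1\otimes t)$ and counit $\varepsilon(s\otimes t)=st$. If $\rho$ is a quasi-Frobenius extension, then $\mathfrak C$ is a quasi-Frobenius $S$-coring. -/

import Mathlib

open CategoryTheory CategoryTheory.Limits MulOpposite

/-! Conventions: all rings are associative and unital, not necessarily commutative. A right
`A`-module is a module over `Aᵐᵒᵖ`, so that `m a` is written `op a • m`. An `(A, B)`-bimodule is an
abelian group with commuting `A`- and `Bᵐᵒᵖ`-module structures. -/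

namespace QF

universe u v w x y z

/-! ### The tensor product over a noncommutative ring -/

section Tensor

/-- The subgroup of `M ⊗_ℤ N` generated by the elements `m a ⊗ n - m ⊗ a n`. -/
def balancing (A : Type u) [Ring A] (M : Type v) [AddCommGroup M] [Module Aᵐᵒᵖ M]
    (N : Type w) [AddCommGroup N] [Module A N] : AddSubgroup (TensorProduct ℤ M N) :=
  AddSubgroup.closure
    {t | ∃ (m : M) (a : A) (n : N),
      t = TensorProduct.tmul ℤ (op a • m) n - TensorProduct.tmul ℤ m (a • n)}

/-- The tensor product `M ⊗_A N` of a right `A`-module and a left `A`-module. -/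
def BTensor (A : Type u) [Ring A] (M : Type v) [AddCommGroup M] [Module Aᵐᵒᵖ M]
    (N : Type w) [AddCommGroup N] [Module A N] : Type (max v w) :=
  TensorProduct ℤ M N ⧸ balancing A M N

variable {A : Type u} [Ring A] {B : Type x} [Ring B]
  {M : Type v} [AddCommGroup M] [Module Aᵐᵒᵖ M]
  {N : Type w} [AddCommGroup N] [Module A N]

instance : AddCommGroup (BTensor A M N) :=
  inferInstanceAs (AddCommGroup (TensorProduct ℤ M N ⧸ balancing A M N))

namespace BTensor

variable (A) in
/-- The element `m ⊗ n` of `M ⊗_A N`. -/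
def tmul (m : M) (n : N) : BTensor A M N :=
  QuotientAddGroup.mk' (balancing A M N) (TensorProduct.tmul ℤ m n)

theorem tmul_add (m : M) (n n' : N) : tmul A m (n + n') = tmul A m n + tmul A m n' := by
  simp only [tmul, TensorProduct.tmul_add]; exact map_add _ _ _

theorem add_tmul (m m' : M) (n : N) : tmul A (m + m') n = tmul A m n + tmul A m' n := by
  simp only [tmul, TensorProduct.add_tmul]; exact map_add _ _ _

@[simp] theorem tmul_zero (m : M) : tmul A m (0 : N) = 0 := by
  simpa using tmul_add (A := A) m (0 : N) 0

@[simp] theorem zero_tmul (n : N) : tmul A (0 : M) n = 0 := by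
  simpa using add_tmul (A := A) (0 : M) 0 n

theorem smul_tmul (m : M) (a : A) (n : N) : tmul A (op a • m) n = tmul A m (a • n) := by
  have h : TensorProduct.tmul ℤ (op a • m) n - TensorProduct.tmul ℤ m (a • n)
      ∈ balancing A M N := AddSubgroup.subset_closure ⟨m, a, n, rfl⟩
  exact (QuotientAddGroup.eq_iff_sub_mem).2 h

/-- The universal property: a biadditive `A`-balanced map factors through `M ⊗_A N`. -/
def lift {P : Type y} [AddCommGroup P] (f : M →+ N →+ P)
    (hf : ∀ (m : M) (a : A) (n : N), f (op a • m) n = f m (a • n)) : BTensor A M N →+ P :=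
  QuotientAddGroup.lift (balancing A M N)
    (TensorProduct.liftAddHom f (fun r m n => by simp))
    (by
      rw [balancing, AddSubgroup.closure_le]
      rintro _ ⟨m, a, n, rfl⟩
      simp [hf])

@[simp] theorem lift_tmul {P : Type y} [AddCommGroup P] (f : M →+ N →+ P)
    (hf : ∀ (m : M) (a : A) (n : N), f (op a • m) n = f m (a • n)) (m : M) (n : N) :
    lift f hf (tmul A m n) = f m n := rfl

theorem induction {p : BTensor A M N → Prop} (h0 : p 0) (ht : ∀ m n, p (tmul A m n))
    (hadd : ∀ s t, p s → p t → p (s + t)) (t : BTensor A M N) : p t := by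
  obtain ⟨t, rfl⟩ := QuotientAddGroup.mk'_surjective (balancing A M N) t
  induction t using TensorProduct.induction_on with
  | zero => rw [map_zero]; exact h0
  | tmul m n => exact ht m n
  | add s t hs ht' => rw [map_add]; exact hadd _ _ hs ht'

theorem hom_ext {P : Type y} [AddCommGroup P] {f g : BTensor A M N →+ P}
    (h : ∀ m n, f (tmul A m n) = g (tmul A m n)) : f = g := by
  ext t
  induction t using induction with
  | h0 => simp
  | ht m n => exact h m n
  | hadd s t hs ht => simp [hs, ht]

/-- `f ⊗_A g` for a right `A`-linear `f` and a left `A`-linear `g`. -/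
def map {M' : Type y} [AddCommGroup M'] [Module Aᵐᵒᵖ M'] {N' : Type z} [AddCommGroup N']
    [Module A N'] (f : M →ₗ[Aᵐᵒᵖ] M') (g : N →ₗ[A] N') : BTensor A M N →+ BTensor A M' N' :=
  lift (AddMonoidHom.mk' (fun m => AddMonoidHom.mk' (fun n => tmul A (f m) (g n))
      (fun n n' => by rw [map_add, tmul_add]))
      (fun m m' => by ext n; simp [add_tmul]))
    (fun m a n => by simp [smul_tmul])

@[simp] theorem map_tmul {M' : Type y} [AddCommGroup M'] [Module Aᵐᵒᵖ M'] {N' : Type z}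
    [AddCommGroup N'] [Module A N'] (f : M →ₗ[Aᵐᵒᵖ] M') (g : N →ₗ[A] N') (m : M) (n : N) :
    map f g (tmul A m n) = tmul A (f m) (g n) := rfl

/-- If `M` is a `(B, A)`-bimodule then `M ⊗_A N` is a left `B`-module, `b (m ⊗ n) = b m ⊗ n`. -/
instance leftModule [Module B M] [SMulCommClass B Aᵐᵒᵖ M] : Module B (BTensor A M N) where
  smul b := map
    { toFun := fun m => b • m
      map_add' := smul_add b
      map_smul' := fun a m => smul_comm b a m } LinearMap.id
  one_smul t := by
    change map _ _ t = t
    induction t using induction with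
    | h0 => simp
    | ht m n => simp
    | hadd s t hs ht => rw [map_add, hs, ht]
  mul_smul b b' t := by
    change map _ _ t = map _ _ (map _ _ t)
    induction t using induction with
    | h0 => simp
    | ht m n => simp [mul_smul]
    | hadd s t hs ht => rw [map_add, map_add, map_add, hs, ht]
  smul_zero b := map_zero _
  smul_add b := map_add _
  add_smul b b' t := by
    change map _ _ t = map _ _ t + map _ _ t
    induction t using induction with
    | h0 => simp
    | ht m n => simp [add_smul, add_tmul]
    | hadd s t hs ht => rw [map_add, map_add, map_add, hs, ht]; abel
  zero_smul t := by
    change map _ _ t = 0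
    induction t using induction with
    | h0 => simp
    | ht m n => simp
    | hadd s t hs ht => rw [map_add, hs, ht, add_zero]

@[simp] theorem left_smul_tmul [Module B M] [SMulCommClass B Aᵐᵒᵖ M] (b : B) (m : M) (n : N) :
    b • tmul A m n = tmul A (b • m) n := rfl

/-- If `N` is an `(A, B)`-bimodule then `M ⊗_A N` is a right `B`-module, `(m ⊗ n) b = m ⊗ n b`. -/
instance rightModule [Module Bᵐᵒᵖ N] [SMulCommClass A Bᵐᵒᵖ N] :
    Module Bᵐᵒᵖ (BTensor A M N) where
  smul b := map LinearMap.id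
    { toFun := fun n => b • n
      map_add' := smul_add b
      map_smul' := fun a n => (smul_comm a b n).symm }
  one_smul t := by
    change map _ _ t = t
    induction t using induction with
    | h0 => simp
    | ht m n => simp
    | hadd s t hs ht => rw [map_add, hs, ht]
  mul_smul b b' t := by
    change map _ _ t = map _ _ (map _ _ t)
    induction t using induction with
    | h0 => simp
    | ht m n => simp [mul_smul]
    | hadd s t hs ht => rw [map_add, map_add, map_add, hs, ht]
  smul_zero b := map_zero _
  smul_add b := map_add _
  add_smul b b' t := by
    change map _ _ t = map _ _ t + map _ _ t
    induction t using induction with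
    | h0 => simp
    | ht m n => simp [add_smul, tmul_add]
    | hadd s t hs ht => rw [map_add, map_add, map_add, hs, ht]; abel
  zero_smul t := by
    change map _ _ t = 0
    induction t using induction with
    | h0 => simp
    | ht m n => simp
    | hadd s t hs ht => rw [map_add, hs, ht, add_zero]

@[simp] theorem right_smul_tmul [Module Bᵐᵒᵖ N] [SMulCommClass A Bᵐᵒᵖ N] (b : Bᵐᵒᵖ)
    (m : M) (n : N) : b • tmul A m n = tmul A m (b • n) := rfl

instance {D : Type y} [Ring D] [Module B M] [SMulCommClass B Aᵐᵒᵖ M] [Module Dᵐᵒᵖ N]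
    [SMulCommClass A Dᵐᵒᵖ N] : SMulCommClass B Dᵐᵒᵖ (BTensor A M N) where
  smul_comm b d t := by
    induction t using induction with
    | h0 => simp
    | ht m n => simp
    | hadd s t hs ht => simp only [smul_add, hs, ht]

/-- The canonical map `M ⊗_A N → Hom(P, M ⊗_A (N ⊗_B P))`. -/
def assocAux [Module Bᵐᵒᵖ N] [SMulCommClass A Bᵐᵒᵖ N] {P : Type y} [AddCommGroup P] [Module B P] :
    BTensor A M N →+ P →+ BTensor A M (BTensor B N P) :=
  lift
    (AddMonoidHom.mk' (fun m => AddMonoidHom.mk' (fun n => AddMonoidHom.mk'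
      (fun p => tmul A m (tmul B n p))
      (fun p p' => by rw [tmul_add, tmul_add]))
      (fun n n' => AddMonoidHom.ext fun p => by
        change tmul A m (tmul B (n + n') p) = tmul A m (tmul B n p) + tmul A m (tmul B n' p)
        rw [add_tmul, tmul_add]))
      (fun m m' => AddMonoidHom.ext fun n => AddMonoidHom.ext fun p => add_tmul m m' _))
    (fun m a n => AddMonoidHom.ext fun p => smul_tmul m a (tmul B n p))

/-- The canonical map `(M ⊗_A N) ⊗_B P → M ⊗_A (N ⊗_B P)`. -/
def assoc [Module Bᵐᵒᵖ N] [SMulCommClass A Bᵐᵒᵖ N] {P : Type y} [AddCommGroup P] [Module B P] :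
    BTensor B (BTensor A M N) P →+ BTensor A M (BTensor B N P) :=
  lift assocAux (fun t b p => by
    induction t using induction with
    | h0 => rw [smul_zero, map_zero]; rfl
    | ht m n => exact congrArg (tmul A m) (smul_tmul n b p)
    | hadd s t hs ht =>
      rw [smul_add, map_add, map_add]
      exact congrArg₂ (· + ·) hs ht)

@[simp] theorem assoc_tmul [Module Bᵐᵒᵖ N] [SMulCommClass A Bᵐᵒᵖ N] {P : Type y}
    [AddCommGroup P] [Module B P] (m : M) (n : N) (p : P) :
    assoc (tmul B (tmul A m n) p) = tmul A m (tmul B n p) := rfl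

/-- The canonical map `M ⊗_A (N ⊗_B P) → (M ⊗_A N) ⊗_B P`, inverse to `assoc`. -/
def assocInv [Module Bᵐᵒᵖ N] [SMulCommClass A Bᵐᵒᵖ N] {P : Type y} [AddCommGroup P]
    [Module B P] : BTensor A M (BTensor B N P) →+ BTensor B (BTensor A M N) P :=
  lift
    (AddMonoidHom.mk'
      (fun m => lift
        (AddMonoidHom.mk' (fun n => AddMonoidHom.mk'
          (fun p => tmul B (tmul A m n) p)
          (fun p p' => tmul_add _ p p'))
          (fun n n' => AddMonoidHom.ext fun p => by
            change tmul B (tmul A m (n + n')) p = tmul B (tmul A m n) p + tmul B (tmul A m n') p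
            rw [tmul_add, add_tmul]))
        (fun n b p => smul_tmul (tmul A m n) b p))
      (fun m m' => hom_ext fun n p => by
        change tmul B (tmul A (m + m') n) p = tmul B (tmul A m n) p + tmul B (tmul A m' n) p
        rw [add_tmul, add_tmul]))
    (fun m a t => by
      induction t using induction with
      | h0 => rw [smul_zero, map_zero, map_zero]
      | ht n p => exact congrArg (fun u => tmul B u p) (smul_tmul m a n)
      | hadd s t hs ht => rw [smul_add, map_add, map_add, hs, ht])

@[simp] theorem assocInv_tmul [Module Bᵐᵒᵖ N] [SMulCommClass A Bᵐᵒᵖ N] {P : Type y}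
    [AddCommGroup P] [Module B P] (m : M) (n : N) (p : P) :
    assocInv (tmul A m (tmul B n p)) = tmul B (tmul A m n) p := rfl

/-- The canonical map `M ⊗_A A → M`, `m ⊗ a ↦ m a`. -/
def rid : BTensor A M A →+ M :=
  lift (AddMonoidHom.mk' (fun m => AddMonoidHom.mk' (fun a => op a • m)
      (fun a a' => by simp [add_smul]))
      (fun m m' => by ext a; simp))
    (fun m a a' => by simp [mul_smul])

@[simp] theorem rid_tmul (m : M) (a : A) : rid (tmul A m a) = op a • m := rfl

/-- The canonical map `A ⊗_A N → N`, `a ⊗ n ↦ a n`. -/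
def lid : BTensor A A N →+ N :=
  lift (AddMonoidHom.mk' (fun a => AddMonoidHom.mk' (fun n => a • n)
      (fun n n' => smul_add a n n'))
      (fun a a' => by ext n; simp [add_smul]))
    (fun a a' n => by simp [mul_smul])

@[simp] theorem lid_tmul (a : A) (n : N) : lid (tmul A a n) = a • n := rfl

end BTensor

end Tensor

/-! ### Homomorphisms and similarity of bimodules -/

/-- Homomorphisms of `(A, B)`-bimodules. -/
structure BimodHom (A : Type u) (B : Type v) [Ring A] [Ring B] (M : Type w) (N : Type x)
    [AddCommGroup M] [Module A M] [Module Bᵐᵒᵖ M] [AddCommGroup N] [Module A N] [Module Bᵐᵒᵖ N]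
    extends M →ₗ[A] N where
  map_op_smul : ∀ (b : B) (m : M), toFun (op b • m) = op b • toFun m

/-- A bimodule homomorphism as a homomorphism of right modules. -/
def BimodHom.toRight {A : Type u} {B : Type v} [Ring A] [Ring B] {M : Type w} {N : Type x}
    [AddCommGroup M] [Module A M] [Module Bᵐᵒᵖ M] [AddCommGroup N] [Module A N] [Module Bᵐᵒᵖ N]
    (f : BimodHom A B M N) : M →ₗ[Bᵐᵒᵖ] N where
  toFun := f.toFun
  map_add' := f.map_add'
  map_smul' b m := f.map_op_smul b.unop m

/-- `M` divides `N` as an `(A, B)`-bimodule: `M` is a direct summand of `N ^ n` for some positive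
integer `n`. -/
def BimodDivides (A : Type u) (B : Type v) [Ring A] [Ring B] (M : Type w) (N : Type x)
    [AddCommGroup M] [Module A M] [Module Bᵐᵒᵖ M]
    [AddCommGroup N] [Module A N] [Module Bᵐᵒᵖ N] : Prop :=
  ∃ n : ℕ, 0 < n ∧ ∃ (φ : BimodHom A B M (Fin n → N)) (ψ : BimodHom A B (Fin n → N) M),
    ∀ m : M, ψ.toLinearMap (φ.toLinearMap m) = m

/-- Similar `(A, B)`-bimodules: each divides the other. -/
def BimodSimilar (A : Type u) (B : Type v) [Ring A] [Ring B] (M : Type w) (N : Type x)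
    [AddCommGroup M] [Module A M] [Module Bᵐᵒᵖ M]
    [AddCommGroup N] [Module A N] [Module Bᵐᵒᵖ N] : Prop :=
  BimodDivides A B M N ∧ BimodDivides A B N M

/-- The left dual `Hom_A(_A M, _A A)` of a left `A`-module. -/
def LeftDual (A : Type u) [Ring A] (M : Type v) [AddCommGroup M] [Module A M] : Type (max u v) :=
  M →ₗ[A] A

namespace LeftDual

variable {A : Type u} [Ring A] {B : Type w} [Ring B] {M : Type v} [AddCommGroup M] [Module A M]

instance : AddCommGroup (LeftDual A M) := inferInstanceAs (AddCommGroup (M →ₗ[A] A))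

/-- The right `A`-module structure `(f a)(m) = f(m) a`. -/
instance : Module Aᵐᵒᵖ (LeftDual A M) := inferInstanceAs (Module Aᵐᵒᵖ (M →ₗ[A] A))

instance : FunLike (LeftDual A M) M A := inferInstanceAs (FunLike (M →ₗ[A] A) M A)

instance : LinearMapClass (LeftDual A M) A M A :=
  inferInstanceAs (LinearMapClass (M →ₗ[A] A) A M A)

theorem op_smul_apply (a : A) (f : LeftDual A M) (m : M) : (op a • f) m = f m * a := rfl

/-- The left `B`-module structure `(b f)(m) = f(m b)` when `M` is an `(A, B)`-bimodule. -/
instance [Module Bᵐᵒᵖ M] [SMulCommClass A Bᵐᵒᵖ M] : Module B (LeftDual A M) where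
  smul b f :=
    { toFun := fun m => f (op b • m)
      map_add' := fun m m' => by rw [smul_add, map_add]
      map_smul' := fun a m => by rw [← smul_comm, map_smul]; rfl }
  one_smul f := LinearMap.ext fun m => congrArg f (one_smul _ m)
  mul_smul b b' f := LinearMap.ext fun m => congrArg f (mul_smul (op b') (op b) m)
  smul_zero b := rfl
  smul_add b f g := rfl
  add_smul b b' f := LinearMap.ext fun m => by
    change f ((op b + op b') • m) = f (op b • m) + f (op b' • m)
    rw [add_smul, map_add]
  zero_smul f := LinearMap.ext fun m => by
    change f ((0 : Bᵐᵒᵖ) • m) = 0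
    rw [zero_smul, map_zero]

theorem smul_apply [Module Bᵐᵒᵖ M] [SMulCommClass A Bᵐᵒᵖ M] (b : B) (f : LeftDual A M) (m : M) :
    (b • f) m = f (op b • m) := rfl

end LeftDual

/-! ### Ring extensions -/

/-- The ring `S`, as the target of a ring homomorphism `ρ : R →+* S`. It is regarded as a bimodule
over `R` and over `S` on either side. -/
def RingExt {R : Type u} {S : Type v} [Ring R] [Ring S] (_ρ : R →+* S) : Type v := S

namespace RingExt

variable {R : Type u} {S : Type v} [Ring R] [Ring S] (ρ : R →+* S)

instance : Ring (RingExt ρ) := inferInstanceAs (Ring S)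

instance : Module S (RingExt ρ) := inferInstanceAs (Module S S)

instance : Module Sᵐᵒᵖ (RingExt ρ) := inferInstanceAs (Module Sᵐᵒᵖ S)

/-- The left `R`-module structure `r s = ρ(r) s`. -/
instance : Module R (RingExt ρ) := Module.compHom S ρ

/-- The right `R`-module structure `s r = s ρ(r)`. -/
instance : Module Rᵐᵒᵖ (RingExt ρ) := Module.compHom S (RingHom.op ρ)

instance : SMulCommClass S Sᵐᵒᵖ (RingExt ρ) := inferInstanceAs (SMulCommClass S Sᵐᵒᵖ S)

instance : SMulCommClass R Sᵐᵒᵖ (RingExt ρ) :=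
  ⟨fun r s t => smul_comm (M := S) (N := Sᵐᵒᵖ) (α := S) (ρ r) s t⟩

instance : SMulCommClass S Rᵐᵒᵖ (RingExt ρ) :=
  ⟨fun s r t => smul_comm (M := S) (N := Sᵐᵒᵖ) (α := S) s (RingHom.op ρ r) t⟩

/-- The identity map `S → S`. -/
def of (s : S) : RingExt ρ := s

/-- The identity map back to `S`. -/
def val {ρ : R →+* S} (s : RingExt ρ) : S := s

theorem smul_of (r : R) (s : S) : r • of ρ s = of ρ (ρ r * s) := rfl

theorem op_smul_of (r : R) (s : S) : op r • of ρ s = of ρ (s * ρ r) := rfl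

end RingExt

/-- A ring homomorphism `ρ : R → S` is a quasi-Frobenius extension when `_R S` is finitely
generated projective and the `(S, R)`-bimodules `S` and `Hom_R(_R S, _R R)` are similar. -/
structure IsQuasiFrobeniusExtension {R : Type u} {S : Type v} [Ring R] [Ring S] (ρ : R →+* S) :
    Prop where
  finite : Module.Finite R (RingExt ρ)
  projective : Module.Projective R (RingExt ρ)
  similar : BimodSimilar S R (RingExt ρ) (LeftDual R (RingExt ρ))

/-! ### Corings and comodules -/

/-- An `A`-coring structure on an `A`-bimodule `C`. -/
structure Coring (A : Type u) (C : Type v) [Ring A] [AddCommGroup C] [Module A C] [Module Aᵐᵒᵖ C]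
    [SMulCommClass A Aᵐᵒᵖ C] where
  comul : BimodHom A A C (BTensor A C C)
  counit : BimodHom A A C A
  coassoc : ∀ c : C,
    BTensor.assoc (BTensor.map comul.toRight LinearMap.id (comul.toLinearMap c)) =
      BTensor.map LinearMap.id comul.toLinearMap (comul.toLinearMap c)
  comul_counit : ∀ c : C,
    BTensor.rid (BTensor.map LinearMap.id counit.toLinearMap (comul.toLinearMap c)) = c
  counit_comul : ∀ c : C,
    BTensor.lid (BTensor.map counit.toRight LinearMap.id (comul.toLinearMap c)) = c

section Comodules

variable {A : Type u} {C : Type v} [Ring A] [AddCommGroup C] [Module A C] [Module Aᵐᵒᵖ C]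
  [SMulCommClass A Aᵐᵒᵖ C]

/-- Right comodules over an `A`-coring. -/
structure Comodule (𝒞 : Coring A C) where
  carrier : ModuleCat.{w} Aᵐᵒᵖ
  coact : carrier →ₗ[Aᵐᵒᵖ] BTensor A carrier C
  coassoc : ∀ m : carrier,
    BTensor.assoc (BTensor.map coact LinearMap.id (coact m)) =
      BTensor.map LinearMap.id 𝒞.comul.toLinearMap (coact m)
  coact_counit : ∀ m : carrier,
    BTensor.rid (BTensor.map LinearMap.id 𝒞.counit.toLinearMap (coact m)) = m

namespace Comodule

variable {𝒞 : Coring A C}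

/-- Right colinear maps. -/
@[ext] structure Hom (M N : Comodule.{u, v, w} 𝒞) where
  hom : M.carrier →ₗ[Aᵐᵒᵖ] N.carrier
  colinear : ∀ m : M.carrier,
    N.coact (hom m) = BTensor.map hom LinearMap.id (M.coact m)

/-- The category of right comodules over an `A`-coring. -/
instance : Category (Comodule.{u, v, w} 𝒞) where
  Hom := Hom
  id M := ⟨LinearMap.id, fun m => by
    induction M.coact m using BTensor.induction with
    | h0 => simp
    | ht m n => simp
    | hadd s t hs ht => simpa using congrArg₂ (· + ·) hs ht⟩
  comp f g := ⟨g.hom.comp f.hom, fun m => by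
    rw [LinearMap.comp_apply, g.colinear, f.colinear]
    generalize Comodule.coact _ m = t
    induction t using BTensor.induction with
    | h0 => simp
    | ht m n => simp
    | hadd s t hs ht => simp only [map_add, hs, ht]⟩

end Comodule

variable (𝒞 : Coring A C)

/-- The coaction `M ⊗_A Δ` on `M ⊗_A C`, with target `(M ⊗_A C) ⊗_A C`. -/
def inducedCoact (M : Type w) [AddCommGroup M] [Module Aᵐᵒᵖ M] :
    BTensor A M C →ₗ[Aᵐᵒᵖ] BTensor A (BTensor A M C) C where
  toFun t := BTensor.assocInv (BTensor.map LinearMap.id 𝒞.comul.toLinearMap t)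
  map_add' s t := by rw [map_add, map_add]
  map_smul' a t := by
    dsimp only [RingHom.id_apply]
    induction t using BTensor.induction with
    | h0 => rw [smul_zero, map_zero, map_zero, smul_zero]
    | hadd s t hs ht => rw [smul_add, map_add, map_add, map_add, map_add, smul_add, hs, ht]
    | ht m c =>
      have h : 𝒞.comul.toLinearMap (a • c) = a • 𝒞.comul.toLinearMap c :=
        𝒞.comul.toRight.map_smul a c
      rw [BTensor.right_smul_tmul, BTensor.map_tmul, BTensor.map_tmul, h]
      generalize 𝒞.comul.toLinearMap c = z
      induction z using BTensor.induction with
      | h0 => rw [smul_zero, BTensor.tmul_zero, map_zero, smul_zero]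
      | hadd s t hs ht =>
        rw [smul_add, BTensor.tmul_add, BTensor.tmul_add, map_add, map_add, smul_add, hs, ht]
      | ht c d => rfl

/-- `c ↦ m ⊗ c` as a right `A`-linear map. -/
def tmulRight {M : Type w} [AddCommGroup M] [Module Aᵐᵒᵖ M] (m : M) : C →ₗ[Aᵐᵒᵖ] BTensor A M C where
  toFun c := BTensor.tmul A m c
  map_add' c d := BTensor.tmul_add m c d
  map_smul' _ _ := rfl

theorem inducedCoact_tmul (M : Type w) [AddCommGroup M] [Module Aᵐᵒᵖ M] (m : M) (c : C) :
    inducedCoact 𝒞 M (BTensor.tmul A m c) =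
      BTensor.map (tmulRight m) LinearMap.id (𝒞.comul.toLinearMap c) := by
  change BTensor.assocInv (BTensor.tmul A m (𝒞.comul.toLinearMap c)) = _
  generalize 𝒞.comul.toLinearMap c = z
  induction z using BTensor.induction with
  | h0 => rw [BTensor.tmul_zero, map_zero, map_zero]
  | hadd s t hs ht => rw [BTensor.tmul_add, map_add, map_add, hs, ht]
  | ht c d => rfl

/-- The right comodule `M ⊗_A C` induced by a right `A`-module `M`. -/
def inducedComodule (M : ModuleCat.{max w v} Aᵐᵒᵖ) : Comodule.{u, v, max w v} 𝒞 where
  carrier := ModuleCat.of Aᵐᵒᵖ (BTensor A M C)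
  coact := inducedCoact 𝒞 M
  coassoc t := by
    change BTensor A M C at t
    induction t using BTensor.induction with
    | h0 => simp only [map_zero]
    | hadd s t hs ht => simp only [map_add, hs, ht]
    | ht m c =>
      rw [inducedCoact_tmul]
      have h1 : ∀ z : BTensor A C C,
          BTensor.assoc (BTensor.map (inducedCoact 𝒞 M) LinearMap.id
            (BTensor.map (tmulRight m) LinearMap.id z)) =
          BTensor.map (tmulRight m) LinearMap.id
            (BTensor.assoc (BTensor.map 𝒞.comul.toRight LinearMap.id z)) := by
        intro z
        induction z using BTensor.induction with
        | h0 => simp only [map_zero]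
        | hadd s t hs ht => simp only [map_add, hs, ht]
        | ht c d =>
          rw [BTensor.map_tmul, BTensor.map_tmul, BTensor.map_tmul]
          change BTensor.assoc (BTensor.tmul A (inducedCoact 𝒞 M (BTensor.tmul A m c)) d) =
            BTensor.map (tmulRight m) LinearMap.id
              (BTensor.assoc (BTensor.tmul A (𝒞.comul.toLinearMap c) d))
          rw [inducedCoact_tmul]
          generalize 𝒞.comul.toLinearMap c = y
          induction y using BTensor.induction with
          | h0 => simp only [map_zero, BTensor.zero_tmul]
          | hadd s t hs ht => simp only [map_add, BTensor.add_tmul, hs, ht]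
          | ht c e => rfl
      have h2 : ∀ z : BTensor A C C,
          BTensor.map LinearMap.id 𝒞.comul.toLinearMap
            (BTensor.map (tmulRight m) LinearMap.id z) =
          BTensor.map (tmulRight m) LinearMap.id
            (BTensor.map LinearMap.id 𝒞.comul.toLinearMap z) := by
        intro z
        induction z using BTensor.induction with
        | h0 => simp only [map_zero]
        | hadd s t hs ht => simp only [map_add, hs, ht]
        | ht c d => rfl
      exact (h1 _).trans ((congrArg _ (𝒞.coassoc c)).trans (h2 _).symm)
  coact_counit t := by
    change BTensor A M C at t
    induction t using BTensor.induction with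
    | h0 => simp only [map_zero]
    | hadd s t hs ht => simp only [map_add, hs, ht]
    | ht m c =>
      rw [inducedCoact_tmul]
      have h : ∀ z : BTensor A C C,
          BTensor.rid (BTensor.map LinearMap.id 𝒞.counit.toLinearMap
            (BTensor.map (tmulRight m) LinearMap.id z)) =
          BTensor.tmul A m
            (BTensor.rid (BTensor.map LinearMap.id 𝒞.counit.toLinearMap z)) := by
        intro z
        induction z using BTensor.induction with
        | h0 => simp only [map_zero, BTensor.tmul_zero]
        | hadd s t hs ht => simp only [map_add, BTensor.tmul_add, hs, ht]
        | ht c d => rfl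
      exact (h _).trans (congrArg _ (𝒞.comul_counit c))

/-- `f ⊗_A C` as a right `A`-linear map. -/
def mapRight {M : Type w} [AddCommGroup M] [Module Aᵐᵒᵖ M] {N : Type x} [AddCommGroup N]
    [Module Aᵐᵒᵖ N] (f : M →ₗ[Aᵐᵒᵖ] N) : BTensor A M C →ₗ[Aᵐᵒᵖ] BTensor A N C where
  toFun := BTensor.map f LinearMap.id
  map_add' := map_add _
  map_smul' a t := by
    dsimp only [RingHom.id_apply]
    induction t using BTensor.induction with
    | h0 => rw [smul_zero, map_zero, smul_zero]
    | hadd s t hs ht => rw [smul_add, map_add, map_add, smul_add, hs, ht]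
    | ht m c => rfl

/-- The induction functor `- ⊗_A C` from right `A`-modules to right `C`-comodules. -/
def inductionFunctor : ModuleCat.{max w v} Aᵐᵒᵖ ⥤ Comodule.{u, v, max w v} 𝒞 where
  obj M := inducedComodule 𝒞 M
  map {M N} f :=
    { hom := mapRight f.hom
      colinear := fun t => by
        change BTensor A M C at t
        change inducedCoact 𝒞 N (mapRight f.hom t) =
          BTensor.map (mapRight f.hom) LinearMap.id (inducedCoact 𝒞 M t)
        induction t using BTensor.induction with
        | h0 => simp only [map_zero]
        | hadd s t hs ht => simp only [map_add, hs, ht]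
        | ht m c =>
          change inducedCoact 𝒞 N (BTensor.tmul A (f.hom m) c) = _
          rw [inducedCoact_tmul, inducedCoact_tmul]
          generalize 𝒞.comul.toLinearMap c = z
          induction z using BTensor.induction with
          | h0 => simp only [map_zero]
          | hadd s t hs ht => simp only [map_add, hs, ht]
          | ht c d => rfl }
  map_id M := Comodule.Hom.ext <| LinearMap.ext fun t => by
    change BTensor A M C at t
    change BTensor.map (𝟙 M : M ⟶ M).hom LinearMap.id t = t
    induction t using BTensor.induction with
    | h0 => simp only [map_zero]
    | hadd s t hs ht => rw [map_add, hs, ht]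
    | ht m c => rfl
  map_comp {M N P} f g := Comodule.Hom.ext <| LinearMap.ext fun t => by
    change BTensor A M C at t
    change BTensor.map (f ≫ g).hom LinearMap.id t =
      BTensor.map g.hom LinearMap.id (BTensor.map f.hom LinearMap.id t)
    induction t using BTensor.induction with
    | h0 => simp only [map_zero]
    | hadd s t hs ht => rw [map_add, map_add, map_add, hs, ht]
    | ht m c => rfl

end Comodules

/-! ### Quasi-Frobenius functors and corings -/

/-- `X` divides `Y` in a category with finite coproducts: `X` is a retract of the coproduct of `n`
copies of `Y` for some positive integer `n`. -/
def Divides {𝒜 : Type u} [Category.{v} 𝒜] [HasFiniteCoproducts 𝒜] (X Y : 𝒜) : Prop :=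
  ∃ n : ℕ, 0 < n ∧ ∃ (φ : X ⟶ ∐ (fun _ : Fin n => Y)) (ψ : (∐ (fun _ : Fin n => Y)) ⟶ X),
    φ ≫ ψ = 𝟙 X

/-- Similar objects: each divides the other. -/
def Similar {𝒜 : Type u} [Category.{v} 𝒜] [HasFiniteCoproducts 𝒜] (X Y : 𝒜) : Prop :=
  Divides X Y ∧ Divides Y X

/-- `F` is a quasi-Frobenius functor: it has a left adjoint `L` and a right adjoint `R` which are
similar as objects of the functor category (whose coproducts are computed pointwise). -/
def IsQuasiFrobeniusFunctor {𝒜 : Type u} [Category.{v} 𝒜] [HasFiniteCoproducts 𝒜] {ℬ : Type w}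
    [Category.{x} ℬ] (F : 𝒜 ⥤ ℬ) : Prop :=
  ∃ L R : ℬ ⥤ 𝒜, Nonempty (L ⊣ F) ∧ Nonempty (F ⊣ R) ∧ Similar L R

/-- An `A`-coring `C` is quasi-Frobenius when the induction functor `- ⊗_A C` is. The modules and
comodules considered live in the universe `max w v`, where `C` lives in universe `v`. -/
def Coring.IsQuasiFrobenius {A : Type u} {C : Type v} [Ring A] [AddCommGroup C] [Module A C]
    [Module Aᵐᵒᵖ C] [SMulCommClass A Aᵐᵒᵖ C] (𝒞 : Coring A C) : Prop :=
  IsQuasiFrobeniusFunctor (inductionFunctor.{u, v, w} 𝒞)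

/-! ### The Sweedler coring -/

section Sweedler

variable {R : Type u} {S : Type v} [Ring R] [Ring S] (ρ : R →+* S)

/-- The `S`-bimodule `S ⊗_R S`. -/
abbrev Sweedler : Type v := BTensor R (RingExt ρ) (RingExt ρ)

/-- The map `S ⊗_R S → (S ⊗_R S) ⊗_S (S ⊗_R S)`, `s ⊗ t ↦ (s ⊗ 1) ⊗ (1 ⊗ t)`. -/
def sweedlerComulHom : Sweedler ρ →+ BTensor S (Sweedler ρ) (Sweedler ρ) :=
  BTensor.lift
    (AddMonoidHom.mk' (fun s => AddMonoidHom.mk'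
      (fun t => BTensor.tmul S (BTensor.tmul R s (1 : RingExt ρ))
        (BTensor.tmul R (1 : RingExt ρ) t))
      (fun t t' => by rw [BTensor.tmul_add, BTensor.tmul_add]))
      (fun s s' => AddMonoidHom.ext fun t => by
        change BTensor.tmul S (BTensor.tmul R (s + s') (1 : RingExt ρ)) _ =
          BTensor.tmul S (BTensor.tmul R s (1 : RingExt ρ)) _ +
          BTensor.tmul S (BTensor.tmul R s' (1 : RingExt ρ)) _
        rw [BTensor.add_tmul, BTensor.add_tmul]))
    (fun s r t => by
      change BTensor.tmul S (BTensor.tmul R (op r • s) (1 : RingExt ρ))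
          (BTensor.tmul R (1 : RingExt ρ) t) =
        BTensor.tmul S (BTensor.tmul R s (1 : RingExt ρ))
          (BTensor.tmul R (1 : RingExt ρ) (r • t))
      have h1 : r • (1 : RingExt ρ) = op (ρ r) • (1 : RingExt ρ) :=
        (mul_one (ρ r)).trans (one_mul (ρ r)).symm
      have h2 : op r • (1 : RingExt ρ) = ρ r • (1 : RingExt ρ) :=
        (one_mul (ρ r)).trans (mul_one (ρ r)).symm
      rw [BTensor.smul_tmul, h1, ← BTensor.smul_tmul (1 : RingExt ρ) r t, h2,
        ← BTensor.right_smul_tmul, BTensor.smul_tmul, BTensor.left_smul_tmul])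

/-- The comultiplication `s ⊗ t ↦ (s ⊗ 1) ⊗ (1 ⊗ t)` as a homomorphism of `S`-bimodules. -/
def sweedlerComul : BimodHom S S (Sweedler ρ) (BTensor S (Sweedler ρ) (Sweedler ρ)) where
  toFun := sweedlerComulHom ρ
  map_add' := map_add _
  map_smul' a t := by
    dsimp only [RingHom.id_apply]
    induction t using BTensor.induction with
    | h0 => rw [smul_zero, map_zero, smul_zero]
    | hadd s t hs ht => rw [smul_add, map_add, map_add, smul_add, hs, ht]
    | ht m c => rfl
  map_op_smul a t := by
    induction t using BTensor.induction with
    | h0 => rw [smul_zero, map_zero, smul_zero]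
    | hadd s t hs ht => rw [smul_add, map_add, map_add, smul_add, hs, ht]
    | ht m c => rfl

theorem sweedlerComul_tmul (s t : RingExt ρ) :
    (sweedlerComul ρ).toLinearMap (BTensor.tmul R s t) =
      BTensor.tmul S (BTensor.tmul R s (1 : RingExt ρ)) (BTensor.tmul R (1 : RingExt ρ) t) := rfl

/-- The multiplication `S ⊗_R S → S`, `s ⊗ t ↦ s t`. -/
def sweedlerCounitHom : Sweedler ρ →+ S :=
  BTensor.lift
    (AddMonoidHom.mk' (fun s => AddMonoidHom.mk' (fun t => s.val * t.val)
      (fun t t' => mul_add s.val t.val t'.val))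
      (fun s s' => AddMonoidHom.ext fun t => add_mul s.val s'.val t.val))
    (fun s r t => mul_assoc s.val (ρ r) t.val)

/-- The counit `s ⊗ t ↦ s t` as a homomorphism of `S`-bimodules. -/
def sweedlerCounit : BimodHom S S (Sweedler ρ) S where
  toFun := sweedlerCounitHom ρ
  map_add' := map_add _
  map_smul' a t := by
    dsimp only [RingHom.id_apply]
    induction t using BTensor.induction with
    | h0 => rw [smul_zero, map_zero, smul_zero]
    | hadd s t hs ht => rw [smul_add, map_add, map_add, smul_add, hs, ht]
    | ht s t => exact mul_assoc a s.val t.val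
  map_op_smul a t := by
    induction t using BTensor.induction with
    | h0 => rw [smul_zero, map_zero, smul_zero]
    | hadd s t hs ht => rw [smul_add, map_add, map_add, smul_add, hs, ht]
    | ht s t => exact (mul_assoc s.val t.val a).symm

theorem sweedlerCounit_tmul (s t : RingExt ρ) :
    (sweedlerCounit ρ).toLinearMap (BTensor.tmul R s t) = s.val * t.val := rfl

/-- The Sweedler coring `S ⊗_R S` of a ring extension `ρ : R → S`. -/
def sweedlerCoring : Coring S (Sweedler ρ) where
  comul := sweedlerComul ρ
  counit := sweedlerCounit ρ
  coassoc t := by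
    induction t using BTensor.induction with
    | h0 => simp only [map_zero]
    | hadd s t hs ht => simp only [map_add, hs, ht]
    | ht m c => rfl
  comul_counit t := by
    induction t using BTensor.induction with
    | h0 => simp only [map_zero]
    | hadd s t hs ht => simp only [map_add, hs, ht]
    | ht s t =>
      exact congrArg (BTensor.tmul R s)
        ((one_mul (1 * t.val)).trans (one_mul t.val))
  counit_comul t := by
    induction t using BTensor.induction with
    | h0 => simp only [map_zero]
    | hadd s t hs ht => simp only [map_add, hs, ht]
    | ht s t =>
      exact congrArg (fun y : RingExt ρ => BTensor.tmul R y t)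
        ((mul_one (s.val * 1)).trans (mul_one s.val))

end Sweedler

end QF

/-! For any coring, induction has the forgetful functor `U` as left adjoint: the unit is the
coaction and the counit is `M ⊗ ε`. For the Sweedler coring, `M ⊗_S (S ⊗_R S)` is `M ⊗_R S`, so a
coaction reads `n ↦ Σ nᵢ ⊗ (1 ⊗ tᵢ)`. Call `n` coinvariant when this is `n ⊗ (1 ⊗ 1)`, and let
`N^co` be the right `R`-module of coinvariants. Then induction has the right adjoint `N ↦ Hom_R(S,
N^co)`, with counit `ψ ⊗ (x ⊗ t) ↦ ψ(x) t`. Neither adjunction needs a condition on `ρ`.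

Let `S*` be the left dual of `S`. Each `f` in `S*` sends `n` to `Σ nᵢ ρ(f tᵢ)`, which is coinvariant
by coassociativity (`dualAct_coinvariant`). A finite dual basis `(e, e')` of `S` over `R` recovers
`n` from these values (`sum_smul_dualAct`, `dualAct_sum`), so that `U N` is `Hom_R(S*, N^co)`,
naturally in `N`.

Thus `U` and the right adjoint are `Hom_R(-, N^co)` at `S*` and at `S`. Bimodule maps between `S`
and `S*` induce natural transformations between the two functors (`toCoinvariantHom`,
`ofCoinvariantHom`), and a relation `Σ bᵢ aᵢ = id` of bimodule maps becomes the same kind of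
relation of natural transformations. Hence similar bimodules give similar functors. -/

namespace QF

universe u v w x y

/-! ### Division in preadditive categories -/

/-- In a preadditive category `X` divides `Y` as soon as `𝟙 X` is a sum of finitely many
endomorphisms factoring through `Y`. -/
theorem divides_of_sum_eq_id {𝒜 : Type u} [Category.{v} 𝒜] [Preadditive 𝒜]
    [HasFiniteCoproducts 𝒜] {X Y : 𝒜} {n : ℕ} (hn : 0 < n) (f : Fin n → (X ⟶ Y))
    (g : Fin n → (Y ⟶ X)) (h : ∑ i, f i ≫ g i = 𝟙 X) : Divides X Y :=
  ⟨n, hn, ∑ i, f i ≫ Sigma.ι (fun _ : Fin n => Y) i, Sigma.desc g, by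
    simp [Preadditive.sum_comp, h]⟩

/-! ### Components of bimodule homomorphisms -/

section Components

variable {A : Type u} {B : Type v} [Ring A] [Ring B] {M : Type w} {N : Type x}
  [AddCommGroup M] [Module A M] [Module Bᵐᵒᵖ M] [AddCommGroup N] [Module A N] [Module Bᵐᵒᵖ N]

/-- The `i`-th component of a homomorphism to `N ^ n`. -/
def BimodHom.component {n : ℕ} (φ : BimodHom A B M (Fin n → N)) (i : Fin n) :
    BimodHom A B M N where
  toLinearMap := (LinearMap.proj i).comp φ.toLinearMap
  map_op_smul b m := congrFun (φ.map_op_smul b m) i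

/-- The restriction of a homomorphism from `N ^ n` to the `i`-th copy of `N`. -/
def BimodHom.restrict {n : ℕ} (ψ : BimodHom A B (Fin n → N) M) (i : Fin n) :
    BimodHom A B N M where
  toLinearMap := ψ.toLinearMap.comp (LinearMap.single A (fun _ => N) i)
  map_op_smul b m := by
    have h : Pi.single (M := fun _ => N) i (op b • m) = op b • Pi.single i m :=
      Pi.single_smul' i (op b) m
    change ψ.toFun (Pi.single i (op b • m)) = op b • ψ.toFun (Pi.single i m)
    rw [h, ψ.map_op_smul]

/-- Divisibility in terms of single maps `M → N → M`, the form that transfers to natural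
transformations and feeds `divides_of_sum_eq_id`. -/
theorem BimodDivides.exists_components (h : BimodDivides A B M N) :
    ∃ n : ℕ, 0 < n ∧ ∃ (a : Fin n → BimodHom A B M N) (b : Fin n → BimodHom A B N M),
      ∀ m : M, ∑ i, (b i).toLinearMap ((a i).toLinearMap m) = m := by
  obtain ⟨n, hn, φ, ψ, h⟩ := h
  refine ⟨n, hn, φ.component, ψ.restrict, fun m => ?_⟩
  refine Eq.trans ?_ (h m)
  conv_rhs => rw [← Finset.univ_sum_single (φ.toLinearMap m), map_sum]
  rfl

end Components

/-- A finitely generated projective module has a finite dual basis. -/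
theorem exists_dualBasis (A : Type u) (M : Type v) [Ring A] [AddCommGroup M] [Module A M]
    [Module.Finite A M] [Module.Projective A M] :
    ∃ (n : ℕ) (e : Fin n → M) (e' : Fin n → LeftDual A M), ∀ m, ∑ j, e' j m • e j = m := by
  obtain ⟨n, f, g, -, -, h⟩ := Module.Finite.exists_comp_eq_id_of_projective A M
  -- The basis consists of the images of the standard vectors under `f : A ^ n → M`; the functionals
  -- are the coordinates of its section `g`.
  refine ⟨n, fun j => f (Pi.single j 1), fun j => (LinearMap.proj j).comp g, fun m => ?_⟩
  have := LinearMap.congr_fun h m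
  refine Eq.trans ?_ this
  change _ = f (g m)
  conv_rhs => rw [← Finset.univ_sum_single (g m), map_sum]
  refine Finset.sum_congr rfl fun j _ => ?_
  change g m j • _ = _
  rw [← map_smul, ← Pi.single_smul, smul_eq_mul, mul_one]

/-! ### The forgetful functor -/

section Forgetful

variable {A : Type u} {C : Type v} [Ring A] [AddCommGroup C] [Module A C] [Module Aᵐᵒᵖ C]
  [SMulCommClass A Aᵐᵒᵖ C] (𝒞 : Coring A C)

/-- The forgetful functor from right comodules to right modules. -/
def forgetfulFunctor : Comodule.{u, v, w} 𝒞 ⥤ ModuleCat.{w} Aᵐᵒᵖ where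
  obj N := N.carrier
  map f := ModuleCat.ofHom (Comodule.Hom.hom f)

/-- Comodule coassociativity is stated through `assoc`, whereas induced coactions are defined
through `assocInv`; this passes between the two. -/
theorem BTensor.assocInv_assoc {M : Type w} [AddCommGroup M] [Module Aᵐᵒᵖ M] {B : Type x} [Ring B]
    {N : Type y} [AddCommGroup N] [Module A N] [Module Bᵐᵒᵖ N] [SMulCommClass A Bᵐᵒᵖ N]
    {P : Type v} [AddCommGroup P] [Module B P] (t : BTensor B (BTensor A M N) P) :
    assocInv (assoc t) = t := by
  induction t using induction with
  | h0 => simp only [map_zero]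
  | hadd s t hs ht => simp only [map_add, hs, ht]
  | ht z p =>
    induction z using induction with
    | h0 => simp only [zero_tmul, map_zero]
    | hadd s t hs ht => simp only [add_tmul, map_add, hs, ht]
    | ht m n => rfl

/-- The map `M ⊗_A ε` from `M ⊗_A C` to `M`, as a homomorphism of right modules. -/
def counitRight (M : Type w) [AddCommGroup M] [Module Aᵐᵒᵖ M] : BTensor A M C →ₗ[Aᵐᵒᵖ] M where
  toFun t := BTensor.rid (BTensor.map LinearMap.id 𝒞.counit.toLinearMap t)
  map_add' s t := by rw [map_add, map_add]
  map_smul' a t := by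
    dsimp only [RingHom.id_apply]
    induction t using BTensor.induction with
    | h0 => simp only [smul_zero, map_zero]
    | hadd s t hs ht => simp only [smul_add, map_add, hs, ht]
    | ht m c =>
      have h : 𝒞.counit.toLinearMap (a • c) = a • 𝒞.counit.toLinearMap c :=
        𝒞.counit.toRight.map_smul a c
      rw [BTensor.right_smul_tmul, BTensor.map_tmul, BTensor.map_tmul, h, BTensor.rid_tmul,
        BTensor.rid_tmul, smul_smul]
      rfl

/-- The coaction of a comodule `N`, as a comodule homomorphism from `N` to `N ⊗_A C`. -/
def coactHom (N : Comodule.{u, v, max w v} 𝒞) :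
    N ⟶ (inductionFunctor.{u, v, w} 𝒞).obj N.carrier :=
  Comodule.Hom.mk (M := N) (N := inducedComodule 𝒞 N.carrier) N.coact fun m => by
    change BTensor.assocInv (BTensor.map LinearMap.id 𝒞.comul.toLinearMap (N.coact m)) = _
    -- Colinearity of the coaction is exactly coassociativity of `N`.
    rw [← N.coassoc, BTensor.assocInv_assoc]
    rfl

/-- The forgetful functor is left adjoint to the induction functor. -/
def forgetfulAdjunction :
    forgetfulFunctor.{u, v, max w v} 𝒞 ⊣ inductionFunctor.{u, v, w} 𝒞 where
  unit :=
    { app := fun N => coactHom.{u, v, w} 𝒞 N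
      naturality := fun M N f => Comodule.Hom.ext <| LinearMap.ext fun m =>
        Comodule.Hom.colinear f m }
  counit :=
    { app := fun M => ModuleCat.ofHom (counitRight 𝒞 M)
      naturality := fun M N f => by
        ext t
        change BTensor A M C at t
        change counitRight 𝒞 N (BTensor.map f.hom LinearMap.id t) = f.hom (counitRight 𝒞 M t)
        induction t using BTensor.induction with
        | h0 => simp only [map_zero]
        | hadd s t hs ht => simp only [map_add, hs, ht]
        | ht m c => exact (f.hom.map_smul _ _).symm }
  left_triangle_components N := by
    ext m
    exact N.coact_counit m
  right_triangle_components M := Comodule.Hom.ext <| LinearMap.ext fun t => by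
    change BTensor A M C at t
    change BTensor.map (counitRight 𝒞 M) LinearMap.id (inducedCoact 𝒞 M t) = t
    induction t using BTensor.induction with
    | h0 => simp only [map_zero]
    | hadd s t hs ht => simp only [map_add, hs, ht]
    | ht m c =>
      rw [inducedCoact_tmul]
      -- With `c` written as `Σ ε(c₁) c₂`, it remains to move `ε(c₁)` across the tensor sign over
      -- `A`.
      conv_rhs => rw [← 𝒞.counit_comul c]
      generalize 𝒞.comul.toLinearMap c = z
      induction z using BTensor.induction with
      | h0 => simp only [map_zero, BTensor.tmul_zero]
      | hadd s t hs ht => simp only [map_add, BTensor.tmul_add, hs, ht]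
      | ht c d => exact BTensor.smul_tmul m (𝒞.counit.toLinearMap c) d

end Forgetful

/-! ### Comodules over the Sweedler coring -/

section SweedlerComodules

variable {R : Type u} {S : Type v} [Ring R] [Ring S] {ρ : R →+* S}

theorem RingExt.smul_one_eq (r : R) : r • (1 : RingExt ρ) = op r • (1 : RingExt ρ) :=
  (mul_one (ρ r)).trans (one_mul (ρ r)).symm

/-- Normal form behind the identification of `M ⊗_S (S ⊗_R S)` with `M ⊗_R S`: the first factor `a`
is absorbed into `m`. -/
theorem tmul_sweedler_tmul {M : Type w} [AddCommGroup M] [Module Sᵐᵒᵖ M] (m : M)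
    (a t : RingExt ρ) :
    BTensor.tmul S m (BTensor.tmul R a t) =
      BTensor.tmul S (op a.val • m) (BTensor.tmul R (1 : RingExt ρ) t) := by
  rw [BTensor.smul_tmul, BTensor.left_smul_tmul]
  exact congrArg (fun z : RingExt ρ => BTensor.tmul S m (BTensor.tmul R z t)) (mul_one a.val).symm

/-- `M ⊗_S (S ⊗_R S)` is generated by the elements `m ⊗ (1 ⊗ t)`. -/
theorem sweedler_induction {M : Type w} [AddCommGroup M] [Module Sᵐᵒᵖ M]
    {p : BTensor S M (Sweedler ρ) → Prop} (h0 : p 0)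
    (hadd : ∀ s t, p s → p t → p (s + t))
    (ht : ∀ (m : M) (t : RingExt ρ), p (BTensor.tmul S m (BTensor.tmul R (1 : RingExt ρ) t)))
    (z : BTensor S M (Sweedler ρ)) : p z := by
  induction z using BTensor.induction with
  | h0 => exact h0
  | hadd s t hs ht => exact hadd s t hs ht
  | ht m c =>
    induction c using BTensor.induction with
    | h0 => rw [BTensor.tmul_zero]; exact h0
    | hadd s t hs ht => rw [BTensor.tmul_add]; exact hadd _ _ hs ht
    | ht a t => rw [tmul_sweedler_tmul]; exact ht _ _

/-- The left `S`-linear map `S ⊗_R S → S`, `s ⊗ t ↦ s ρ(f t)`. -/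
def sweedlerEval (f : LeftDual R (RingExt ρ)) : Sweedler ρ →ₗ[S] S where
  toFun := BTensor.lift
    (AddMonoidHom.mk' (fun s => AddMonoidHom.mk' (fun t => s.val * ρ (f t))
      (fun t t' => by rw [map_add, map_add, mul_add]))
      (fun s s' => AddMonoidHom.ext fun t => add_mul s.val s'.val _))
    (fun s r t => by
      change s.val * ρ r * ρ (f t) = s.val * ρ (f (r • t))
      rw [map_smul, smul_eq_mul, map_mul, mul_assoc])
  map_add' := map_add _
  map_smul' a c := by
    dsimp only [RingHom.id_apply]
    induction c using BTensor.induction with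
    | h0 => simp only [smul_zero, map_zero]
    | hadd s t hs ht => simp only [smul_add, map_add, hs, ht]
    | ht s t => exact mul_assoc a s.val _

/-- The map `M ⊗_S (S ⊗_R S) → M`, `m ⊗ (s ⊗ t) ↦ m s ρ(f t)`. -/
def contract {M : Type w} [AddCommGroup M] [Module Sᵐᵒᵖ M] (f : LeftDual R (RingExt ρ)) :
    BTensor S M (Sweedler ρ) →+ M :=
  BTensor.rid.comp (BTensor.map LinearMap.id (sweedlerEval f))

/-! ### Contraction of the last tensor factor against the dual of `S` -/

section contract

variable {M : Type w} [AddCommGroup M] [Module Sᵐᵒᵖ M]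

theorem contract_tmul (f : LeftDual R (RingExt ρ)) (m : M) (t : RingExt ρ) :
    contract f (BTensor.tmul S m (BTensor.tmul R (1 : RingExt ρ) t)) = op (ρ (f t)) • m :=
  congrArg (fun s => op s • m) (one_mul (ρ (f t)))

theorem contract_add (f g : LeftDual R (RingExt ρ)) (z : BTensor S M (Sweedler ρ)) :
    contract (f + g) z = contract f z + contract g z := by
  induction z using sweedler_induction with
  | h0 => simp only [map_zero, add_zero]
  | hadd s t hs ht => simp only [map_add, hs, ht]; abel
  | ht m t =>
    simp only [contract_tmul]
    change op (ρ (f t + g t)) • m = _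
    rw [map_add]
    exact add_smul (op (ρ (f t))) (op (ρ (g t))) m

theorem contract_op_smul (f : LeftDual R (RingExt ρ)) (r : R) (z : BTensor S M (Sweedler ρ)) :
    contract (op r • f) z = op (ρ r) • contract f z := by
  induction z using sweedler_induction with
  | h0 => simp only [map_zero, smul_zero]
  | hadd s t hs ht => simp only [map_add, smul_add, hs, ht]
  | ht m t =>
    rw [contract_tmul, contract_tmul, LeftDual.op_smul_apply, map_mul, op_mul, mul_smul]

/-- `S` acts on `z` through the last factor, and `f(t s) = (s f)(t)`. The `S`-linearity of both
comparison maps comes from here. -/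
theorem contract_right_smul (f : LeftDual R (RingExt ρ)) (s : S) (z : BTensor S M (Sweedler ρ)) :
    contract f (op s • z) = contract (s • f) z := by
  induction z using sweedler_induction with
  | h0 => simp only [map_zero, smul_zero]
  | hadd s t hs ht => simp only [map_add, smul_add, hs, ht]
  | ht m t =>
    rw [BTensor.right_smul_tmul, BTensor.right_smul_tmul, contract_tmul, contract_tmul,
      LeftDual.smul_apply]

theorem contract_map {N : Type x} [AddCommGroup N] [Module Sᵐᵒᵖ N] (f : LeftDual R (RingExt ρ))
    (g : M →ₗ[Sᵐᵒᵖ] N) (z : BTensor S M (Sweedler ρ)) :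
    contract f (BTensor.map g LinearMap.id z) = g (contract f z) := by
  induction z using sweedler_induction with
  | h0 => simp only [map_zero]
  | hadd s t hs ht => simp only [map_add, hs, ht]
  | ht m t =>
    rw [BTensor.map_tmul, LinearMap.id_apply, contract_tmul, contract_tmul, map_smul]

/-- On `m ⊗ (1 ⊗ t)` this is the dual basis expansion `Σ ρ(e'ⱼ t) eⱼ = t`, both sides being `m t`.
-/
theorem sum_contract_smul {n : ℕ} {e : Fin n → RingExt ρ} {e' : Fin n → LeftDual R (RingExt ρ)}
    (he : ∀ t, ∑ j, e' j t • e j = t) (z : BTensor S M (Sweedler ρ)) :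
    ∑ j, op (e j).val • contract (e' j) z = counitRight (sweedlerCoring ρ) M z := by
  induction z using sweedler_induction with
  | h0 => simp only [map_zero, smul_zero, Finset.sum_const_zero]
  | hadd s t hs ht => simp only [map_add, smul_add, Finset.sum_add_distrib, hs, ht]
  | ht m t =>
    simp only [contract_tmul, smul_smul, ← op_mul]
    change _ = op ((1 : S) * t.val) • m
    rw [← Finset.sum_smul, ← Finset.op_sum, one_mul]
    exact congrArg (fun s : RingExt ρ => op s.val • m) (he t)

/-- The map `(S ⊗_R S) ⊗_S (S ⊗_R S) → S ⊗_R S`, `c ⊗ (s ⊗ t) ↦ c s ρ(f t)`. -/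
def contractSweedler (f : LeftDual R (RingExt ρ)) :
    BTensor S (Sweedler ρ) (Sweedler ρ) →ₗ[S] Sweedler ρ where
  toFun := contract f
  map_add' := map_add _
  map_smul' a z := by
    dsimp only [RingHom.id_apply]
    induction z using sweedler_induction with
    | h0 => simp only [map_zero, smul_zero]
    | hadd s t hs ht => simp only [map_add, smul_add, hs, ht]
    | ht c t =>
      rw [BTensor.left_smul_tmul, contract_tmul, contract_tmul]
      exact (smul_comm a _ c).symm

/-- Since `Δ(1 ⊗ t) = (1 ⊗ 1) ⊗ (1 ⊗ t)`, contraction leaves `1 ⊗ ρ(f t)`. As `f t` lies in `R`, it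
crosses `⊗_R` to give `ρ(f t) ⊗ 1`, and then crosses `⊗_S` into `m`. -/
theorem contractSweedler_comul (f : LeftDual R (RingExt ρ)) (z : BTensor S M (Sweedler ρ)) :
    BTensor.map LinearMap.id (contractSweedler f)
        (BTensor.map LinearMap.id (sweedlerCoring ρ).comul.toLinearMap z) =
      BTensor.tmul S (contract f z) (BTensor.tmul R (1 : RingExt ρ) (1 : RingExt ρ)) := by
  induction z using sweedler_induction with
  | h0 => simp only [map_zero, BTensor.zero_tmul]
  | hadd s t hs ht => simp only [map_add, BTensor.add_tmul, hs, ht]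
  | ht m t =>
    rw [contract_tmul, BTensor.smul_tmul]
    change BTensor.tmul S m (contract f (BTensor.tmul S (BTensor.tmul R (1 : RingExt ρ) 1)
      (BTensor.tmul R (1 : RingExt ρ) t))) = _
    rw [contract_tmul, BTensor.right_smul_tmul, BTensor.left_smul_tmul]
    have h1 : op (ρ (f t)) • (1 : RingExt ρ) = f t • (1 : RingExt ρ) :=
      (RingExt.smul_one_eq (f t)).symm
    have h2 : op (f t) • (1 : RingExt ρ) = ρ (f t) • (1 : RingExt ρ) :=
      (RingExt.smul_one_eq (f t)).symm
    rw [h1, ← BTensor.smul_tmul, h2]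

end contract

/-! ### Coinvariants and the action of the dual of `S` -/

variable (N : Comodule.{v, v, w} (sweedlerCoring ρ))

/-- The element `Σ nᵢ f(tᵢ)` of a comodule, for a coaction `n ↦ Σ nᵢ ⊗ (1 ⊗ tᵢ)`. -/
def dualAct (n : N.carrier) (f : LeftDual R (RingExt ρ)) : N.carrier := contract f (N.coact n)

/-- An element `n` is coinvariant when its coaction is `n ⊗ (1 ⊗ 1)`. -/
def IsCoinvariant (n : N.carrier) : Prop :=
  N.coact n = BTensor.tmul S n (BTensor.tmul R (1 : RingExt ρ) (1 : RingExt ρ))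

variable {N}

theorem IsCoinvariant.coact_smul {n : N.carrier} (h : IsCoinvariant N n) (s : RingExt ρ) :
    N.coact (op s.val • n) = BTensor.tmul S n (BTensor.tmul R (1 : RingExt ρ) s) := by
  rw [map_smul, h, BTensor.right_smul_tmul, BTensor.right_smul_tmul]
  exact congrArg (fun t : RingExt ρ => BTensor.tmul S n (BTensor.tmul R (1 : RingExt ρ) t))
    (one_mul s.val)

/-- Contracting and then coacting is the same as coacting on the first factor and then contracting
the last. Coassociativity turns the latter into a contraction of `Δ`, computed by
`contractSweedler_comul`. -/
theorem dualAct_coinvariant (n : N.carrier) (f : LeftDual R (RingExt ρ)) :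
    IsCoinvariant N (dualAct N n f) := by
  have h : ∀ z : BTensor S N.carrier (Sweedler ρ), N.coact (contract f z) =
      BTensor.map LinearMap.id (contractSweedler f)
        (BTensor.assoc (BTensor.map N.coact LinearMap.id z)) := by
    intro z
    induction z using sweedler_induction with
    | h0 => simp only [map_zero]
    | hadd s t hs ht => simp only [map_add, hs, ht]
    | ht m t =>
      rw [contract_tmul, BTensor.map_tmul, map_smul]
      generalize N.coact m = y
      induction y using BTensor.induction with
      | h0 => simp only [map_zero, smul_zero, BTensor.zero_tmul]
      | hadd s t hs ht => simp only [map_add, smul_add, BTensor.add_tmul, hs, ht]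
      | ht m c =>
        exact congrArg (BTensor.tmul S m) (contract_tmul f c t).symm
  rw [IsCoinvariant, dualAct, h, N.coassoc, contractSweedler_comul]

variable (N) in
/-- The right `R`-linear maps from `S` to the coinvariants of a comodule. -/
def coinvariantHom : AddSubgroup (RingExt ρ →+ N.carrier) where
  carrier := {ψ | (∀ (r : R) (x : RingExt ρ), ψ (op r • x) = op (ρ r) • ψ x) ∧
    ∀ x, IsCoinvariant N (ψ x)}
  zero_mem' := ⟨fun r x => (smul_zero _).symm, fun x => by simp [IsCoinvariant]⟩
  add_mem' {ψ θ} hψ hθ := ⟨fun r x => by simp [hψ.1, hθ.1], fun x => by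
    have h1 := hψ.2 x
    have h2 := hθ.2 x
    simp only [IsCoinvariant] at h1 h2 ⊢
    rw [AddMonoidHom.add_apply, map_add, h1, h2, BTensor.add_tmul]⟩
  neg_mem' {ψ} hψ := ⟨fun r x => by simp [hψ.1], fun x => by
    have h1 := hψ.2 x
    simp only [IsCoinvariant] at h1 ⊢
    rw [AddMonoidHom.neg_apply, map_neg, h1, neg_eq_iff_add_eq_zero, ← BTensor.add_tmul,
      add_neg_cancel, BTensor.zero_tmul]⟩

namespace coinvariantHom

instance : FunLike (coinvariantHom N) (RingExt ρ) N.carrier where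
  coe ψ := ψ.1
  coe_injective _ _ h := Subtype.ext (DFunLike.coe_injective h)

instance : AddMonoidHomClass (coinvariantHom N) (RingExt ρ) N.carrier where
  map_add ψ := map_add ψ.1
  map_zero ψ := map_zero ψ.1

@[ext] theorem ext {ψ θ : coinvariantHom N} (h : ∀ x, ψ x = θ x) : ψ = θ := DFunLike.ext _ _ h

theorem map_op_smul (ψ : coinvariantHom N) (r : R) (x : RingExt ρ) :
    ψ (op r • x) = op (ρ r) • ψ x := ψ.2.1 r x

theorem coinvariant (ψ : coinvariantHom N) (x : RingExt ρ) : IsCoinvariant N (ψ x) := ψ.2.2 x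

theorem add_apply (ψ θ : coinvariantHom N) (x : RingExt ρ) : (ψ + θ) x = ψ x + θ x := rfl

/-- The right `S`-module structure `(ψ s)(x) = ψ(s x)`. -/
instance : Module Sᵐᵒᵖ (coinvariantHom N) where
  smul s ψ := ⟨AddMonoidHom.mk' (fun x => ψ (s.unop • x)) fun x y => by rw [smul_add, map_add],
    fun r x => by
      change ψ (s.unop • op r • x) = op (ρ r) • ψ (s.unop • x)
      rw [smul_comm, map_op_smul],
    fun x => ψ.2.2 _⟩
  one_smul ψ := ext fun x => congrArg ψ (one_smul S x)
  mul_smul s t ψ := ext fun x => congrArg ψ (mul_smul t.unop s.unop x)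
  smul_zero s := rfl
  smul_add s ψ θ := rfl
  add_smul s t ψ := ext fun x => by
    change ψ ((s.unop + t.unop) • x) = ψ (s.unop • x) + ψ (t.unop • x)
    rw [add_smul, map_add]
  zero_smul ψ := ext fun x => by
    change ψ ((0 : S) • x) = 0
    rw [zero_smul, map_zero]

end coinvariantHom

end SweedlerComodules

/-! ### The right adjoint of the induction functor -/

section RightAdjoint

variable {R : Type u} {S : Type v} [Ring R] [Ring S] (ρ : R →+* S)

/-- Composition with a comodule homomorphism. -/
def coinvariantHom.map {N P : Comodule.{v, v, w} (sweedlerCoring ρ)} (f : N ⟶ P) :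
    coinvariantHom N →ₗ[Sᵐᵒᵖ] coinvariantHom P where
  toFun ψ := ⟨(Comodule.Hom.hom f).toAddMonoidHom.comp ψ.1,
    fun r x => by
      change Comodule.Hom.hom f (ψ (op r • x)) = op (ρ r) • Comodule.Hom.hom f (ψ x)
      rw [coinvariantHom.map_op_smul, map_smul],
    fun x => by
      have h : N.coact (ψ x) = _ := coinvariantHom.coinvariant ψ x
      change P.coact (Comodule.Hom.hom f (ψ x)) = BTensor.tmul S (Comodule.Hom.hom f (ψ x)) _
      rw [Comodule.Hom.colinear f, h]
      rfl⟩
  map_add' ψ θ := coinvariantHom.ext fun x => map_add (Comodule.Hom.hom f) (ψ x) (θ x)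
  map_smul' s ψ := rfl

/-- The functor sending a comodule to the right `R`-linear maps from `S` to its coinvariants. -/
def coinvariantHomFunctor :
    Comodule.{v, v, max w v} (sweedlerCoring ρ) ⥤ ModuleCat.{max w v} Sᵐᵒᵖ where
  obj N := ModuleCat.of Sᵐᵒᵖ (coinvariantHom N)
  map f := ModuleCat.ofHom (coinvariantHom.map ρ f)

/-- The map `m ↦ (x ↦ m ⊗ (x ⊗ 1))`. -/
def coinvariantUnit (M : ModuleCat.{max w v} Sᵐᵒᵖ) :
    M →ₗ[Sᵐᵒᵖ] coinvariantHom (inducedComodule.{v, v, w} (sweedlerCoring ρ) M) where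
  toFun m := ⟨AddMonoidHom.mk' (fun x => BTensor.tmul S m (BTensor.tmul R x (1 : RingExt ρ)))
      (fun x y => by rw [BTensor.add_tmul, BTensor.tmul_add]; rfl),
    fun r x => by
      change BTensor.tmul S m (BTensor.tmul R (op r • x) (1 : RingExt ρ)) =
        BTensor.tmul S m (BTensor.tmul R x (op (ρ r) • (1 : RingExt ρ)))
      rw [BTensor.smul_tmul, RingExt.smul_one_eq]
      rfl,
    -- Coinvariance of `m ⊗ (x ⊗ 1)` is the formula `Δ(x ⊗ 1) = (x ⊗ 1) ⊗ (1 ⊗ 1)`.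
    fun x => inducedCoact_tmul (sweedlerCoring ρ) M m _⟩
  map_add' m n := coinvariantHom.ext fun x => BTensor.add_tmul m n _
  map_smul' s m := coinvariantHom.ext fun x =>
    BTensor.smul_tmul m s.unop (BTensor.tmul R x (1 : RingExt ρ))

variable {ρ} in
/-- The map `ψ ⊗ (x ⊗ t) ↦ ψ(x) t`. -/
def coinvariantEval (N : Comodule.{v, v, w} (sweedlerCoring ρ)) :
    BTensor S (coinvariantHom N) (Sweedler ρ) →ₗ[Sᵐᵒᵖ] N.carrier where
  toFun := BTensor.lift
    (AddMonoidHom.mk' (fun ψ => BTensor.lift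
      (AddMonoidHom.mk' (fun x => AddMonoidHom.mk' (fun t => op t.val • ψ x)
        (fun t t' => add_smul (op t.val) (op t'.val) (ψ x)))
        (fun x x' => AddMonoidHom.ext fun t => by
          change op t.val • ψ (x + x') = op t.val • ψ x + op t.val • ψ x'
          rw [map_add, smul_add]))
      -- Balancing over `R` is the right `R`-linearity of `ψ`; balancing over `S`, below, is the
      -- definition `(ψ s)(x) = ψ(s x)`.
      (fun x r t => by
        change op t.val • ψ (op r • x) = op (ρ r * t.val) • ψ x
        rw [coinvariantHom.map_op_smul, smul_smul, op_mul]))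
      (fun ψ θ => BTensor.hom_ext fun x t => smul_add (op t.val) (ψ x) (θ x)))
    (fun ψ s c => by
      induction c using BTensor.induction with
      | h0 => simp only [map_zero, smul_zero]
      | hadd s t hs ht => simp only [map_add, smul_add, hs, ht]
      | ht x t => rfl)
  map_add' := map_add _
  map_smul' s z := by
    dsimp only [RingHom.id_apply]
    induction z using sweedler_induction with
    | h0 => simp only [map_zero, smul_zero]
    | hadd s t hs ht => simp only [map_add, smul_add, hs, ht]
    | ht ψ t => exact mul_smul s (op t.val) (ψ 1)

theorem coinvariantEval_tmul {N : Comodule.{v, v, w} (sweedlerCoring ρ)} (ψ : coinvariantHom N)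
    (x t : RingExt ρ) :
    coinvariantEval N (BTensor.tmul S ψ (BTensor.tmul R x t)) = op t.val • ψ x := rfl

/-- `coinvariantEval` as a comodule homomorphism. -/
def coinvariantCounit (N : Comodule.{v, v, max w v} (sweedlerCoring ρ)) :
    (inductionFunctor.{v, v, w} (sweedlerCoring ρ)).obj ((coinvariantHomFunctor.{u, v, w} ρ).obj N)
      ⟶ N :=
  Comodule.Hom.mk (M := inducedComodule.{v, v, w} (sweedlerCoring ρ)
      (ModuleCat.of Sᵐᵒᵖ (coinvariantHom N))) (N := N) (coinvariantEval N) fun z => by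
    change BTensor S (coinvariantHom N) (Sweedler ρ) at z
    change N.coact (coinvariantEval N z) = BTensor.map (coinvariantEval N) LinearMap.id
      (inducedCoact (sweedlerCoring ρ) (coinvariantHom N) z)
    induction z using sweedler_induction with
    | h0 => simp only [map_zero]
    | hadd s t hs ht => simp only [map_add, hs, ht]
    | ht ψ t =>
      -- As `ψ(1)` is coinvariant, `ψ(1) t` has coaction `ψ(1) ⊗ (1 ⊗ t)`.
      rw [coinvariantEval_tmul, (coinvariantHom.coinvariant ψ 1).coact_smul, inducedCoact_tmul]
      exact congrArg (fun n => BTensor.tmul S n (BTensor.tmul R (1 : RingExt ρ) t))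
        (one_smul Sᵐᵒᵖ (ψ 1)).symm

/-- The induction functor of a Sweedler coring is left adjoint to `coinvariantHomFunctor`. -/
def coinvariantHomAdjunction :
    inductionFunctor.{v, v, w} (sweedlerCoring ρ) ⊣ coinvariantHomFunctor.{u, v, w} ρ where
  unit := { app := fun M => ModuleCat.ofHom (coinvariantUnit.{u, v, w} ρ M) }
  counit :=
    { app := fun N => coinvariantCounit.{u, v, w} ρ N
      naturality := fun N P f => Comodule.Hom.ext <| LinearMap.ext fun z => by
        change BTensor S (coinvariantHom N) (Sweedler ρ) at z
        change coinvariantEval P (BTensor.map (coinvariantHom.map ρ f) LinearMap.id z) =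
          Comodule.Hom.hom f (coinvariantEval N z)
        induction z using sweedler_induction with
        | h0 => simp only [map_zero]
        | hadd s t hs ht => simp only [map_add, hs, ht]
        | ht ψ t => exact ((Comodule.Hom.hom f).map_smul _ _).symm }
  left_triangle_components M := Comodule.Hom.ext <| LinearMap.ext fun z => by
    change BTensor S M (Sweedler ρ) at z
    change coinvariantEval (inducedComodule.{v, v, w} (sweedlerCoring ρ) M)
      (BTensor.map (coinvariantUnit.{u, v, w} ρ M) LinearMap.id z) = z
    induction z using sweedler_induction with
    | h0 => simp only [map_zero]; rfl
    | hadd s t hs ht => simp only [map_add, hs, ht]; rfl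
    | ht m t =>
      exact congrArg (fun s : RingExt ρ => BTensor.tmul S m (BTensor.tmul R (1 : RingExt ρ) s))
        (one_mul t.val)
  right_triangle_components N := by
    ext ψ
    exact coinvariantHom.ext fun x => one_smul Sᵐᵒᵖ ((show coinvariantHom N from ψ) x)

end RightAdjoint

/-! ### Comparison of the two adjoints -/

section Comparison

variable {R : Type u} {S : Type v} [Ring R] [Ring S] {ρ : R →+* S}

/-- An `(S, R)`-bimodule map `a` from `S` to its dual induces a natural transformation from the
forgetful functor to `coinvariantHomFunctor`, with `n ↦ (x ↦ Σ nᵢ a(x)(tᵢ))`. -/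
def toCoinvariantHom (a : BimodHom S R (RingExt ρ) (LeftDual R (RingExt ρ))) :
    forgetfulFunctor.{v, v, max w v} (sweedlerCoring ρ) ⟶ coinvariantHomFunctor.{u, v, w} ρ where
  app N := ModuleCat.ofHom
    { toFun := fun n =>
        ⟨AddMonoidHom.mk' (fun x => dualAct N n (a.toLinearMap x)) fun x y => by
          rw [map_add, dualAct, contract_add, dualAct, dualAct],
          fun r x => (congrArg (dualAct N n) (a.map_op_smul r x)).trans (contract_op_smul _ _ _),
          fun x => dualAct_coinvariant _ _⟩
      map_add' := fun m n => coinvariantHom.ext fun x => by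
        change contract _ (N.coact (m + n)) = _
        rw [map_add, map_add]
        rfl
      map_smul' := fun s n => coinvariantHom.ext fun x => by
        change contract _ (N.coact (op s.unop • n)) =
          contract (a.toLinearMap (s.unop • x)) (N.coact n)
        -- The last rewrite is left `S`-linearity of `a`; its right `R`-linearity served above for
        -- the map in `x`.
        rw [map_smul, contract_right_smul, map_smul] }
  naturality N P f := by
    ext (n : N.carrier)
    refine coinvariantHom.ext fun x => ?_
    change contract _ (P.coact (Comodule.Hom.hom f n)) =
      Comodule.Hom.hom f (contract _ (N.coact n))
    rw [Comodule.Hom.colinear f]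
    exact contract_map _ _ _

variable {n : ℕ} {e : Fin n → RingExt ρ} {e' : Fin n → LeftDual R (RingExt ρ)}

/-- An `R`-linear map `θ` from the dual of `S` to the coinvariants of a comodule is given by the
action on the element `Σ θ(e'ⱼ) eⱼ`, for a dual basis `(e, e')`. -/
theorem dualAct_sum (he : ∀ t, ∑ j, e' j t • e j = t)
    {N : Comodule.{v, v, w} (sweedlerCoring ρ)} (θ : LeftDual R (RingExt ρ) →+ N.carrier)
    (hθ : ∀ (r : R) f, θ (op r • f) = op (ρ r) • θ f) (hc : ∀ f, IsCoinvariant N (θ f))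
    (f : LeftDual R (RingExt ρ)) :
    dualAct N (∑ j, op (e j).val • θ (e' j)) f = θ f := by
  -- The functionals `e'` generate the dual as a right `R`-module, with coefficients `f(eⱼ)`.
  have hf : f = ∑ j, op (f (e j)) • e' j := by
    refine DFunLike.ext _ _ fun t => ?_
    conv_lhs => rw [← he t, map_sum]
    refine Eq.trans ?_ (LinearMap.sum_apply Finset.univ
      (fun j => (op (f (e j)) • e' j : LeftDual R (RingExt ρ))) t).symm
    exact Finset.sum_congr rfl fun j _ => map_smul f (e' j t) (e j)
  rw [dualAct, map_sum, map_sum]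
  conv_rhs => rw [hf, map_sum]
  refine Finset.sum_congr rfl fun j _ => ?_
  -- Coinvariance gives `θ(e'ⱼ) eⱼ` the coaction `θ(e'ⱼ) ⊗ (1 ⊗ eⱼ)`, which contracts to `θ(e'ⱼ) ρ(f
  -- eⱼ)`.
  rw [(hc (e' j)).coact_smul, contract_tmul, hθ]

/-- Dual basis expansion followed by the counit axiom. Together with `dualAct_sum` it identifies `N`
with the right `R`-linear maps from the dual of `S` to the coinvariants. -/
theorem sum_smul_dualAct (he : ∀ t, ∑ j, e' j t • e j = t)
    (N : Comodule.{v, v, w} (sweedlerCoring ρ)) (m : N.carrier) :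
    ∑ j, op (e j).val • dualAct N m (e' j) = m :=
  (sum_contract_smul he (N.coact m)).trans (N.coact_counit m)

/-- The composite of `ψ` with a bimodule map from the dual of `S` to `S`. -/
def coinvariantHom.dualComp {N : Comodule.{v, v, w} (sweedlerCoring ρ)} (ψ : coinvariantHom N)
    (b : BimodHom S R (LeftDual R (RingExt ρ)) (RingExt ρ)) :
    LeftDual R (RingExt ρ) →+ N.carrier :=
  ψ.1.comp b.toLinearMap.toAddMonoidHom

theorem dualAct_sum_dualComp (he : ∀ t, ∑ j, e' j t • e j = t)
    {N : Comodule.{v, v, w} (sweedlerCoring ρ)} (ψ : coinvariantHom N)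
    (b : BimodHom S R (LeftDual R (RingExt ρ)) (RingExt ρ)) (f : LeftDual R (RingExt ρ)) :
    dualAct N (∑ j, op (e j).val • ψ (b.toLinearMap (e' j))) f = ψ (b.toLinearMap f) :=
  dualAct_sum he (coinvariantHom.dualComp ψ b)
    (fun r f => (congrArg ψ (b.map_op_smul r f)).trans (coinvariantHom.map_op_smul ψ r _))
    (fun _ => coinvariantHom.coinvariant ψ _) f

/-- An `(S, R)`-bimodule map `b` from the dual of `S` to `S` induces a natural transformation from
`coinvariantHomFunctor` to the forgetful functor, with `ψ ↦ Σ ψ(b(e'ⱼ)) eⱼ`. -/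
def ofCoinvariantHom (he : ∀ t, ∑ j, e' j t • e j = t)
    (b : BimodHom S R (LeftDual R (RingExt ρ)) (RingExt ρ)) :
    coinvariantHomFunctor.{u, v, w} ρ ⟶ forgetfulFunctor.{v, v, max w v} (sweedlerCoring ρ) where
  app N := ModuleCat.ofHom
    { toFun := fun (ψ : coinvariantHom N) => ∑ j, op (e j).val • ψ (b.toLinearMap (e' j))
      map_add' := fun ψ θ => by
        simp only [coinvariantHom.add_apply, smul_add, Finset.sum_add_distrib]
      map_smul' := fun s ψ => by
        dsimp only [RingHom.id_apply]
        -- The formula does not show `S`-linearity, so the right side is expanded by its values at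
        -- the `e'ⱼ`. With `m = Σ ψ(b(e'ₖ)) eₖ`, the value of `m s` at `e'ⱼ` is that of `m` at `s
        -- e'ⱼ`, namely `ψ(b(s e'ⱼ)) = (ψ s)(b(e'ⱼ))`.
        rw [← sum_smul_dualAct he N (s • ∑ j, op (e j).val • ψ (b.toLinearMap (e' j)))]
        refine Finset.sum_congr rfl fun j _ => congrArg _ ?_
        have h := contract_right_smul (e' j) s.unop
          (N.coact (∑ j, op (e j).val • ψ (b.toLinearMap (e' j))))
        rw [← map_smul] at h
        refine Eq.trans ?_ (h.trans (dualAct_sum_dualComp he ψ b _)).symm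
        rw [map_smul]
        rfl }
  naturality N P f := by
    ext ψ
    change coinvariantHom N at ψ
    change ∑ j, op (e j).val • Comodule.Hom.hom f (ψ (b.toLinearMap (e' j))) = _
    refine Eq.trans (Finset.sum_congr rfl fun j _ => ?_) (map_sum (Comodule.Hom.hom f)
      (fun j => op (e j).val • ψ (b.toLinearMap (e' j))) Finset.univ).symm
    exact ((Comodule.Hom.hom f).map_smul _ _).symm

/-- A sum of composites of natural transformations is the identity as soon as it is so on elements. -/
theorem natTrans_sum_eq_id {𝒜 : Type u} [Category.{v} 𝒜] {A : Type w} [Ring A]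
    {F G : 𝒜 ⥤ ModuleCat.{x} A} {k : ℕ} (f : Fin k → (F ⟶ G)) (g : Fin k → (G ⟶ F))
    (h : ∀ (X : 𝒜) (m : F.obj X), ∑ i, (g i).app X ((f i).app X m) = m) :
    ∑ i, f i ≫ g i = 𝟙 F := by
  ext X m
  simpa [NatTrans.app_sum, ModuleCat.hom_sum] using h X m

theorem coinvariantHom.sum_apply {N : Comodule.{v, v, w} (sweedlerCoring ρ)} {k : ℕ}
    (ψ : Fin k → coinvariantHom N) (x : RingExt ρ) : (∑ i, ψ i) x = ∑ i, ψ i x :=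
  map_sum ((AddMonoidHom.eval x).comp (coinvariantHom N).subtype) ψ Finset.univ

theorem dualAct_sum_right {N : Comodule.{v, v, w} (sweedlerCoring ρ)} (m : N.carrier) {k : ℕ}
    (f : Fin k → LeftDual R (RingExt ρ)) :
    dualAct N m (∑ i, f i) = ∑ i, dualAct N m (f i) :=
  map_sum (AddMonoidHom.mk' (dualAct N m) fun f g => contract_add f g _) f Finset.univ

end Comparison

end QF

-- Similarity of the two adjoints

universe u v w

theorem proposition7p8 {R : Type u} {S : Type v} [Ring R] [Ring S] (ρ : R →+* S)
    (hρ : QF.IsQuasiFrobeniusExtension ρ) :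
    QF.Coring.IsQuasiFrobenius.{v, v, w} (QF.sweedlerCoring ρ) := by
  obtain ⟨hfin, hproj, hSD, hDS⟩ := hρ
  obtain ⟨n, e, e', he⟩ := QF.exists_dualBasis R (QF.RingExt ρ)
  refine ⟨QF.forgetfulFunctor _, QF.coinvariantHomFunctor.{u, v, w} ρ,
    ⟨QF.forgetfulAdjunction.{v, v, w} _⟩, ⟨QF.coinvariantHomAdjunction.{u, v, w} ρ⟩, ?_, ?_⟩
  -- The forgetful functor corresponds to the dual, so its divisibility comes from that of the dual
  -- by `S`. `Hom` being contravariant, `b i` induces the first map and `a i` the second.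
  · obtain ⟨k, hk, a, b, h⟩ := hDS.exists_components
    refine QF.divides_of_sum_eq_id hk (fun i => QF.toCoinvariantHom (b i))
      (fun i => QF.ofCoinvariantHom he (a i)) ?_
    refine QF.natTrans_sum_eq_id _ _ fun N m => ?_
    change N.carrier at m
    change ∑ i, ∑ j, op (e j).val •
      QF.dualAct N m ((b i).toLinearMap ((a i).toLinearMap (e' j))) = m
    rw [Finset.sum_comm]
    refine Eq.trans (Finset.sum_congr rfl fun j _ => ?_) (QF.sum_smul_dualAct he N m)
    -- For each `j`, the sum over `i` collapses to the action of `Σ bᵢ(aᵢ(e'ⱼ)) = e'ⱼ`.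
    rw [← Finset.smul_sum, ← QF.dualAct_sum_right, h]
  · obtain ⟨k, hk, a, b, h⟩ := hSD.exists_components
    refine QF.divides_of_sum_eq_id hk (fun i => QF.ofCoinvariantHom he (b i))
      (fun i => QF.toCoinvariantHom (a i)) ?_
    refine QF.natTrans_sum_eq_id _ _ fun N ψ => QF.coinvariantHom.ext fun x => ?_
    change QF.coinvariantHom N at ψ
    refine (QF.coinvariantHom.sum_apply (N := N) _ x).trans ?_
    -- The `i`-th composite sends `ψ` to `x ↦ ψ(bᵢ(aᵢ x))`, and these add up to `ψ(x)`.
    refine Eq.trans (Finset.sum_congr rfl fun i _ =>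
      QF.dualAct_sum_dualComp he ψ (b i) ((a i).toLinearMap x)) ?_
    rw [← map_sum, h]
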